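/- Let $P_1,P_2,P_3,P_4$ be the vertices, numbered counterclockwise, of a convex quadrilateral in the Euclidean plane (strictly convex: no three consecutive vertices are collinear). For points $A,B,C,D,S,S'$, let $T$ be the tree with the five straight edges $AS,\ BS,\ SS',\ CS',\ DS'$. We say that $T$ is a full Steiner tree of topology $(A,B)\,S\,S'\,(D,C)$ if its six vertices are distinct, two different edges meet at most in a common end point, $S$ is the Steiner point of the triangle $ABS'$, and $S'$ is the Steiner point of the triangle $CDS$. Here a point is the Steiner point of a non-degenerate triangle if all the angles of the triangle are less than $2\pi/3$ and the point minimizes the sum of the distances to the three vertices. A Steiner minimal tree on $P_1,\dots,P_4$ is a finite system of line segments whose union is connected and contains $P_1,\dots,P_4$, and whose total length is least among all such systems. Suppose that there exist a full Steiner tree of topology $(P_1,P_2)\,S_1S_2\,(P_4,P_3)$, of length $d$, and a full Steiner tree of topology $(P_4,P_1)\,\tilde S_1\tilde S_2\,(P_3,P_2)$, of length $\tilde d$. Then: 1. The angles between the diagonals are less than $2\pi/3$, that is, both the angle between $\overrightarrow{P_1P_3}$ and $\overrightarrow{P_2P_4}$ and its supplement (the angle between $\overrightarrow{P_1P_3}$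 and $\overrightarrow{P_4P_2}$) are less than $2\pi/3$. 2. $d^2-\tilde d^2=-2\,\langle\overrightarrow{P_1P_3},\overrightarrow{P_2P_4}\rangle$. 3. If the diagonals are perpendicular, then both trees are Steiner minimal trees on $P_1,\dots,P_4$. 4. If the diagonals are not perpendicular, then exactly one of the two trees has its two Steiner points inside the two acute vertical angles formed by the diagonals, one in each, and this tree is the Steiner minimal tree on $P_1,\dots,P_4$: it is a Steiner minimal tree, and every Steiner minimal tree on $P_1,\dots,P_4$ has the same union as it. -/

import Mathlib

open EuclideanGeometry

namespace SteinerFour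

/-- The Euclidean plane. -/
abbrev Plane : Type := EuclideanSpace ℝ (Fin 2)

/-! ### Systems of line segments and Steiner minimal trees -/

/-- A finite system of line segments, each given by its two end points. -/
abbrev SegmentSystem : Type := List (Plane × Plane)

/-- The union of the segments of a system. -/
def carrier (L : SegmentSystem) : Set Plane :=
  ⋃ e ∈ L, segment ℝ e.1 e.2

/-- The sum of the lengths of the segments of a system. -/
noncomputable def totalLength (L : SegmentSystem) : ℝ :=
  (L.map fun e => dist e.1 e.2).sum

/-- The union of the system is a connected set that contains all the terminals. -/
def Interconnects (L : SegmentSystem) (terminals : Set Plane) : Prop :=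
  IsConnected (carrier L) ∧ terminals ⊆ carrier L

/-- `L` solves the Euclidean Steiner minimal tree problem for the given terminals: it has the
least total length among all finite systems of segments whose union is connected and contains
the terminals. -/
def IsSteinerMinimal (terminals : Set Plane) (L : SegmentSystem) : Prop :=
  Interconnects L terminals ∧
    ∀ L' : SegmentSystem, Interconnects L' terminals → totalLength L ≤ totalLength L'

/-- `L` is a Steiner minimal tree and, as a point set, it is the only one. (As systems of
segments minimizers are never unique, since a segment may be subdivided.) -/
def IsUniqueSteinerMinimal (terminals : Set Plane) (L : SegmentSystem) : Prop :=
  IsSteinerMinimal terminals L ∧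
    ∀ L' : SegmentSystem, IsSteinerMinimal terminals L' → carrier L' = carrier L

/-! ### Full Steiner trees on four terminals -/

/-- `S` is the Steiner (Fermat-Torricelli) point of the triangle `ABC`: all the angles of the
triangle are less than `2π/3`, and `S` minimizes the sum of the distances to the vertices. -/
structure IsSteinerPoint (A B C S : Plane) : Prop where
  triangle : AffineIndependent ℝ ![A, B, C]
  angle_left : ∠ C A B < 2 * Real.pi / 3
  angle_mid : ∠ A B C < 2 * Real.pi / 3
  angle_right : ∠ B C A < 2 * Real.pi / 3
  minimizes : ∀ X : Plane, dist S A + dist S B + dist S C ≤ dist X A + dist X B + dist X C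

/-- The edges of the tree in which the terminals `A`, `B` are joined to `S₁`, the terminals
`C`, `D` are joined to `S₂`, and `S₁` is joined to `S₂`. -/
def treeEdges (A B C D S₁ S₂ : Plane) : SegmentSystem :=
  [(A, S₁), (B, S₁), (S₁, S₂), (C, S₂), (D, S₂)]

/-- The points `S₁`, `S₂` are the Steiner points of a full Steiner tree on the terminals
`A`, `B`, `C`, `D` in which `A`, `B` are joined to `S₁`, and `C`, `D` to `S₂`.
The six vertices are distinct, so by the shape of `treeEdges` each of `S₁`, `S₂` has valency
three and each terminal has valency one. -/
structure IsFullSteinerTree (A B C D S₁ S₂ : Plane) : Prop where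
  vertices_distinct : [A, B, C, D, S₁, S₂].Nodup
  /-- Two different edges can meet only in a common end point. -/
  not_self_intersecting : (treeEdges A B C D S₁ S₂).Pairwise fun e f =>
    segment ℝ e.1 e.2 ∩ segment ℝ f.1 f.2 ⊆ {e.1, e.2} ∩ {f.1, f.2}
  steiner_point_left : IsSteinerPoint A B S₂ S₁
  steiner_point_right : IsSteinerPoint C D S₁ S₂

/-! ### Convex quadrilaterals and the angles formed by their diagonals -/

/-- Twice the signed area of the triangle `ABC`, positive iff `A`, `B`, `C` are numbered
counterclockwise. -/
def signedArea (A B C : Plane) : ℝ :=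
  (B 0 - A 0) * (C 1 - A 1) - (B 1 - A 1) * (C 0 - A 0)

/-- `P₁P₂P₃P₄` is a convex quadrilateral whose vertices are numbered counterclockwise:
at each of its vertices the boundary turns strictly to the left. -/
structure IsConvexQuadrilateral (P₁ P₂ P₃ P₄ : Plane) : Prop where
  turn₂ : 0 < signedArea P₁ P₂ P₃
  turn₃ : 0 < signedArea P₂ P₃ P₄
  turn₄ : 0 < signedArea P₃ P₄ P₁
  turn₁ : 0 < signedArea P₄ P₁ P₂

/-- The interior of the angle `UXV` with vertex `X`. -/
def angleInterior (U X V : Plane) : Set Plane :=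
  {Y | ∃ s t : ℝ, 0 < s ∧ 0 < t ∧ Y = X + s • (U - X) + t • (V - X)}

/-- The points `Y` and `Z` lie inside the two angles of the pair of vertical angles `UXV`,
`U'XV'`, one in each. -/
def LieInVerticalAngles (U V U' V' X Y Z : Plane) : Prop :=
  (Y ∈ angleInterior U X V ∧ Z ∈ angleInterior U' X V') ∨
    (Y ∈ angleInterior U' X V' ∧ Z ∈ angleInterior U X V)

/-- The points `Y` and `Z` lie inside the acute vertical angles formed by the diagonals of
`P₁P₂P₃P₄`, one in each. Here `X` is the common point of the diagonals, and the two pairs of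
vertical angles are `P₁XP₂`, `P₃XP₄` and `P₂XP₃`, `P₄XP₁`. -/
def LieInAcuteVerticalAngles (P₁ P₂ P₃ P₄ Y Z : Plane) : Prop :=
  ∃ X ∈ segment ℝ P₁ P₃ ∩ segment ℝ P₂ P₄,
    (∠ P₁ X P₂ < Real.pi / 2 ∧ LieInVerticalAngles P₁ P₂ P₃ P₄ X Y Z) ∨
      (∠ P₂ X P₃ < Real.pi / 2 ∧ LieInVerticalAngles P₂ P₃ P₄ P₁ X Y Z)

end SteinerFour

open SteinerFour

namespace SteinerFour

/-! ### Polygonal paths and trees with four leaves inside a set -/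

/-! Write p = P₃ - P₁, q = P₄ - P₂. The minimum condition at the Steiner points says that unit
vectors along the three edges sum to zero; convexity then fixes the shape: the edges of the first
tree have the directions u, v, w, up to sign, with u + v + w = 0 (`exists_isSteinerFrame`).

Hence d² = ‖p‖² + ‖q‖² - ⟨p, q⟩ + √3 · cross p q (`length_sq`). Passing to the other tree replaces
(p, q) by (-q, p), which only changes the sign of ⟨p, q⟩; this gives the difference of squares. The
same computation gives √3⟨p, q⟩ + cross p q > 0, which bounds the angle between the diagonals. Each
Steiner point lies in the angle at the crossing of the diagonals that faces its own two terminals,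
so the sign of ⟨p, q⟩ decides which tree lies in the acute angles.

For minimality, a connected system of length ℓ contains, for one of the three pairings of the
terminals, a four-leaf tree of length at most ℓ (`spansFour_of_isConnected`). For the pairings of
the two given trees, projecting the edges to the directions ±u, ±v, ±w bounds its length below by d
or d̃ (`length_le`); the pairing by diagonals costs at least ‖p‖ + ‖q‖ > d (`length_lt_diagonals`).
For uniqueness, equality forces a minimizer to contain the tree (`eq_of_length_eq`), and any further
point would cost additional Hausdorff measure (`carrier_eq_of_subset`). -/

/-- A polygonal path inside `K`, of length `ℓ`, from `x` to `y`. -/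
inductive PolygonalPath (K : Set Plane) : Plane → Plane → ℝ → Prop
  | nil (x : Plane) : PolygonalPath K x x 0
  | cons {x y z : Plane} {ℓ : ℝ} (h : segment ℝ x y ⊆ K) (p : PolygonalPath K y z ℓ) :
      PolygonalPath K x z (dist x y + ℓ)

theorem segment_subset_union_of_mem {x y z : Plane} (h : y ∈ segment ℝ x z) :
    segment ℝ x z ⊆ segment ℝ x y ∪ segment ℝ y z := by
  rw [segment_eq_image_lineMap] at h
  obtain ⟨r, hr, rfl⟩ := h
  have h₁ : segment ℝ x (AffineMap.lineMap x z r) = AffineMap.lineMap x z '' Set.Icc (0 : ℝ) r := by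
    rw [← segment_eq_Icc hr.1, image_segment, AffineMap.lineMap_apply_zero]
  have h₂ : segment ℝ (AffineMap.lineMap x z r) z = AffineMap.lineMap x z '' Set.Icc r (1 : ℝ) := by
    rw [← segment_eq_Icc hr.2, image_segment, AffineMap.lineMap_apply_one]
  rw [h₁, h₂, ← Set.image_union, Set.Icc_union_Icc_eq_Icc hr.1 hr.2, segment_eq_image_lineMap]

namespace PolygonalPath

variable {K K' : Set Plane} {x y z : Plane} {ℓ m : ℝ}

theorem mono (h : K ⊆ K') (p : PolygonalPath K x y ℓ) : PolygonalPath K' x y ℓ := by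
  induction p with
  | nil x => exact nil x
  | cons hs _ ih => exact cons (hs.trans h) ih

theorem single (h : segment ℝ x y ⊆ K) : PolygonalPath K x y (dist x y) := by
  simpa using cons h (nil y)

theorem trans (p : PolygonalPath K x y ℓ) (q : PolygonalPath K y z m) :
    PolygonalPath K x z (ℓ + m) := by
  induction p with
  | nil x => simpa using q
  | cons hs _ ih => rw [add_assoc]; exact cons hs (ih q)

theorem symm (p : PolygonalPath K x y ℓ) : PolygonalPath K y x ℓ := by
  induction p with
  | nil x => exact nil x
  | cons hs _ ih =>
    rw [add_comm, dist_comm]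
    exact ih.trans (single (by rwa [segment_symm]))

theorem dist_le (p : PolygonalPath K x y ℓ) : dist x y ≤ ℓ := by
  induction p with
  | nil x => simp
  | cons hs _ ih => exact (dist_triangle _ _ _).trans (by gcongr)

theorem nonneg (p : PolygonalPath K x y ℓ) : 0 ≤ ℓ :=
  dist_nonneg.trans p.dist_le

/-- Equality in the triangle inequality puts the first vertex on the segment, and the rest of the
path is again as short as possible. -/
theorem segment_subset (p : PolygonalPath K x y ℓ) (hne : x ≠ y) (h : ℓ ≤ dist x y) :
    segment ℝ x y ⊆ K := by
  induction p with
  | nil x => exact absurd rfl hne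
  | @cons x y z ℓ hs p ih =>
    have h1 := p.dist_le
    have h2 := dist_triangle x y z
    have hmem : y ∈ segment ℝ x z := by
      rw [mem_segment_iff_wbtw]
      exact dist_add_dist_eq_iff.1 (by linarith)
    rcases eq_or_ne y z with rfl | hyz
    · exact hs
    have h3 := ih hyz (by linarith)
    exact (segment_subset_union_of_mem hmem).trans (Set.union_subset hs h3)

end PolygonalPath

/-- Polygonal paths inside `K` join `A` and `B` to a point `S`, `C` and `D` to a point `T`, and
`S` to `T`, and their total length is at most `ℓ`. -/
def HasFourTree (K : Set Plane) (A B C D : Plane) (ℓ : ℝ) : Prop :=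
  ∃ (S T : Plane) (a b c d e : ℝ), PolygonalPath K A S a ∧ PolygonalPath K B S b ∧
    PolygonalPath K C T c ∧ PolygonalPath K D T d ∧ PolygonalPath K S T e ∧
    a + b + c + d + e ≤ ℓ

/-- One of the three pairings of `A`, `B`, `C`, `D` has a tree in `K` of length at most `ℓ`. -/
def HasSomeFourTree (K : Set Plane) (A B C D : Plane) (ℓ : ℝ) : Prop :=
  HasFourTree K A B C D ℓ ∨ HasFourTree K A C B D ℓ ∨ HasFourTree K A D B C ℓ

/-- Polygonal paths inside `K` join `A`, `B` and `C` to a common point, and their total length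
is at most `ℓ`. -/
def HasStar (K : Set Plane) (A B C : Plane) (ℓ : ℝ) : Prop :=
  ∃ (S : Plane) (a b c : ℝ), PolygonalPath K A S a ∧ PolygonalPath K B S b ∧
    PolygonalPath K C S c ∧ a + b + c ≤ ℓ

/-- Any four points of `K` are the leaves of a tree in `K` of length at most `ℓ`. -/
def SpansFour (K : Set Plane) (ℓ : ℝ) : Prop :=
  ∀ A ∈ K, ∀ B ∈ K, ∀ C ∈ K, ∀ D ∈ K, HasSomeFourTree K A B C D ℓ

/-! ### Re-pairing, extending and gluing four-leaf trees. -/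

section FourTrees

variable {K K' : Set Plane} {A B C D X : Plane} {ℓ m : ℝ}

theorem HasFourTree.swap_left (h : HasFourTree K A B C D ℓ) : HasFourTree K B A C D ℓ := by
  obtain ⟨S, T, a, b, c, d, e, ha, hb, hc, hd, he, hl⟩ := h
  exact ⟨S, T, b, a, c, d, e, hb, ha, hc, hd, he, by linarith⟩

theorem HasFourTree.swap_right (h : HasFourTree K A B C D ℓ) : HasFourTree K A B D C ℓ := by
  obtain ⟨S, T, a, b, c, d, e, ha, hb, hc, hd, he, hl⟩ := h
  exact ⟨S, T, a, b, d, c, e, ha, hb, hd, hc, he, by linarith⟩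

theorem HasFourTree.swap_pairs (h : HasFourTree K A B C D ℓ) : HasFourTree K C D A B ℓ := by
  obtain ⟨S, T, a, b, c, d, e, ha, hb, hc, hd, he, hl⟩ := h
  exact ⟨T, S, c, d, a, b, e, hc, hd, ha, hb, he.symm, by linarith⟩

/-- The three adjacent transpositions generate all permutations of the leaves, so later case
distinctions need only one ordering each. -/
theorem HasSomeFourTree.swap12 (h : HasSomeFourTree K A B C D ℓ) :
    HasSomeFourTree K B A C D ℓ := by
  rcases h with h | h | h
  · exact .inl h.swap_left
  · exact .inr (.inr h.swap_pairs)
  · exact .inr (.inl h.swap_pairs)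

theorem HasSomeFourTree.swap23 (h : HasSomeFourTree K A B C D ℓ) :
    HasSomeFourTree K A C B D ℓ := by
  rcases h with h | h | h
  · exact .inr (.inl h)
  · exact .inl h
  · exact .inr (.inr h.swap_right)

theorem HasSomeFourTree.swap34 (h : HasSomeFourTree K A B C D ℓ) :
    HasSomeFourTree K A B D C ℓ := by
  rcases h with h | h | h
  · exact .inl h.swap_right
  · exact .inr (.inr h)
  · exact .inr (.inl h)

theorem HasFourTree.mono (h : HasFourTree K A B C D ℓ) (hK : K ⊆ K') :
    HasFourTree K' A B C D ℓ := by
  obtain ⟨S, T, a, b, c, d, e, ha, hb, hc, hd, he, hl⟩ := h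
  exact ⟨S, T, a, b, c, d, e, ha.mono hK, hb.mono hK, hc.mono hK, hd.mono hK, he.mono hK, hl⟩

theorem HasFourTree.mono_length (h : HasFourTree K A B C D ℓ) (hm : ℓ ≤ m) :
    HasFourTree K A B C D m := by
  obtain ⟨S, T, a, b, c, d, e, ha, hb, hc, hd, he, hl⟩ := h
  exact ⟨S, T, a, b, c, d, e, ha, hb, hc, hd, he, hl.trans hm⟩

theorem HasSomeFourTree.mono (h : HasSomeFourTree K A B C D ℓ) (hK : K ⊆ K') (hm : ℓ ≤ m) :
    HasSomeFourTree K' A B C D m :=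
  h.imp (fun h => (h.mono hK).mono_length hm)
    (Or.imp (fun h => (h.mono hK).mono_length hm) fun h => (h.mono hK).mono_length hm)

theorem HasFourTree.extend (h : HasFourTree K A B C X ℓ) (p : PolygonalPath K X D m) :
    HasFourTree K A B C D (ℓ + m) := by
  obtain ⟨S, T, a, b, c, d, e, ha, hb, hc, hd, he, hl⟩ := h
  exact ⟨S, T, a, b, c, m + d, e, ha, hb, hc, p.symm.trans hd, he, by linarith⟩

theorem HasSomeFourTree.extend (h : HasSomeFourTree K A B C X ℓ) (p : PolygonalPath K X D m) :
    HasSomeFourTree K A B C D (ℓ + m) := by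
  rcases h with h | h | h
  · exact .inl (h.extend p)
  · exact .inr (.inl (h.extend p))
  · exact .inr (.inr (h.swap_pairs.extend p).swap_pairs)

theorem HasStar.mono (h : HasStar K A B C ℓ) (hK : K ⊆ K') : HasStar K' A B C ℓ := by
  obtain ⟨S, a, b, c, ha, hb, hc, hl⟩ := h
  exact ⟨S, a, b, c, ha.mono hK, hb.mono hK, hc.mono hK, hl⟩

theorem HasStar.join (h : HasStar K A B X ℓ) (h' : HasStar K C D X m) :
    HasFourTree K A B C D (ℓ + m) := by
  obtain ⟨S, a, b, c, ha, hb, hc, hl⟩ := h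
  obtain ⟨S', a', b', c', ha', hb', hc', hl'⟩ := h'
  exact ⟨S, S', a, b, a', b', c + c', ha, hb, ha', hb', hc.symm.trans hc', by linarith⟩

/-- Apply the hypothesis to A, B, X, X and drop one of the two legs ending in X. -/
theorem SpansFour.hasStar (h : SpansFour K ℓ) (hA : A ∈ K) (hB : B ∈ K) (hX : X ∈ K) :
    HasStar K A B X ℓ := by
  have key : ∀ {A B : Plane}, HasFourTree K A X B X ℓ → HasStar K A B X ℓ := by
    rintro A B ⟨S, T, a, b, c, d, e, ha, hb, hc, hd, he, hl⟩
    exact ⟨S, a, c + e, b, ha, hc.trans he.symm, hb, by linarith [hd.nonneg]⟩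
  rcases h A hA B hB X hX X hX with h | h | h
  · obtain ⟨S, T, a, b, c, d, e, ha, hb, hc, hd, he, hl⟩ := h
    exact ⟨S, a, b, c + e, ha, hb, hc.trans he.symm, by linarith [hd.nonneg]⟩
  · exact key h
  · exact key h

theorem SpansFour.exists_path (h : SpansFour K ℓ) (hA : A ∈ K) (hX : X ∈ K) :
    ∃ m ≤ ℓ, PolygonalPath K A X m := by
  obtain ⟨S, a, b, c, ha, hb, hc, hl⟩ := h.hasStar hA hA hX
  exact ⟨a + c, by linarith [hb.nonneg], ha.trans hc.symm⟩

/-- The leaves split as 4+0, 3+1 or 2+2 between the two sets. For 3+1, X serves as fourth leaf on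
the larger side and is then joined to the remaining leaf; for 2+2, two stars are joined at X. This
gluing needs the property for all quadruples of points, not just for the terminals. -/
theorem SpansFour.union (h : SpansFour K ℓ) (h' : SpansFour K' m) (hX : X ∈ K) (hX' : X ∈ K') :
    SpansFour (K ∪ K') (ℓ + m) := by
  have hℓ : 0 ≤ ℓ := by
    obtain ⟨k, hk, p⟩ := h.exists_path hX hX
    exact p.nonneg.trans hk
  have hm : 0 ≤ m := by
    obtain ⟨k, hk, p⟩ := h'.exists_path hX' hX'
    exact p.nonneg.trans hk
  have sub : K ⊆ K ∪ K' := Set.subset_union_left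
  have sub' : K' ⊆ K ∪ K' := Set.subset_union_right
  have k31 : ∀ A ∈ K, ∀ B ∈ K, ∀ C ∈ K, ∀ D ∈ K', HasSomeFourTree (K ∪ K') A B C D (ℓ + m) := by
    intro A hA B hB C hC D hD
    obtain ⟨k, hk, p⟩ := h'.exists_path hX' hD
    exact (((h A hA B hB C hC X hX).mono sub le_rfl).extend (p.mono sub')).mono subset_rfl
      (by linarith)
  have k13 : ∀ A ∈ K', ∀ B ∈ K', ∀ C ∈ K', ∀ D ∈ K,
      HasSomeFourTree (K ∪ K') A B C D (ℓ + m) := by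
    intro A hA B hB C hC D hD
    obtain ⟨k, hk, p⟩ := h.exists_path hX hD
    exact (((h' A hA B hB C hC X hX').mono sub' le_rfl).extend (p.mono sub)).mono subset_rfl
      (by linarith)
  have k22 : ∀ A ∈ K, ∀ B ∈ K, ∀ C ∈ K', ∀ D ∈ K',
      HasSomeFourTree (K ∪ K') A B C D (ℓ + m) := by
    intro A hA B hB C hC D hD
    exact .inl (((h.hasStar hA hB hX).mono sub).join ((h'.hasStar hC hD hX').mono sub'))
  rintro A (hA | hA) B (hB | hB) C (hC | hC) D (hD | hD)
  · exact (h A hA B hB C hC D hD).mono sub (by linarith)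
  · exact k31 A hA B hB C hC D hD
  · exact (k31 A hA B hB D hD C hC).swap34
  · exact k22 A hA B hB C hC D hD
  · exact (k31 A hA C hC D hD B hB).swap34.swap23
  · exact (k22 A hA C hC B hB D hD).swap23
  · exact (k22 A hA D hD B hB C hC).swap23.swap34
  · exact (k13 B hB C hC D hD A hA).swap34.swap23.swap12
  · exact (k31 B hB C hC D hD A hA).swap34.swap23.swap12
  · exact (k22 B hB C hC A hA D hD).swap23.swap12
  · exact (k22 B hB D hD A hA C hC).swap23.swap12.swap34
  · exact (k13 A hA C hC D hD B hB).swap34.swap23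
  · exact (k22 C hC D hD A hA B hB).swap23.swap12.swap34.swap23
  · exact (k13 A hA B hB D hD C hC).swap34
  · exact k13 A hA B hB C hC D hD
  · exact (h' A hA B hB C hC D hD).mono sub' (by linarith)

theorem spansFour_segment (x y : Plane) : SpansFour (segment ℝ x y) (dist x y) := by
  let f : ℝ → Plane := AffineMap.lineMap x y
  let G : ℝ → ℝ → ℝ → ℝ → Prop := fun s₁ s₂ s₃ s₄ =>
    HasSomeFourTree (segment ℝ x y) (f s₁) (f s₂) (f s₃) (f s₄) (dist x y)
  have hdist : ∀ s t, dist (f s) (f t) = |s - t| * dist x y := fun s t => by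
    simp only [f]; rw [dist_lineMap_lineMap, Real.dist_eq]
  have hseg : ∀ s ∈ Set.Icc (0 : ℝ) 1, ∀ t ∈ Set.Icc (0 : ℝ) 1,
      PolygonalPath (segment ℝ x y) (f s) (f t) (dist (f s) (f t)) := fun s hs t ht =>
    .single ((convex_segment x y).segment_subset
      (by rw [segment_eq_image_lineMap]; exact ⟨s, hs, rfl⟩)
      (by rw [segment_eq_image_lineMap]; exact ⟨t, ht, rfl⟩))
  have k4 : ∀ s₁ ∈ Set.Icc (0 : ℝ) 1, ∀ s₂ ∈ Set.Icc (0 : ℝ) 1, ∀ s₃ ∈ Set.Icc (0 : ℝ) 1,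
      ∀ s₄ ∈ Set.Icc (0 : ℝ) 1, s₁ ≤ s₂ → s₂ ≤ s₃ → s₃ ≤ s₄ → G s₁ s₂ s₃ s₄ := by
    intro s₁ h₁ s₂ h₂ s₃ h₃ s₄ h₄ h12 h23 h34
    -- For sorted parameters the inner vertices are the two middle points, and the total is the
    -- distance of the outer ones. The claims below insert the unsorted parameters one at a time.
    refine .inl ⟨f s₂, f s₃, _, _, _, _, _, hseg _ h₁ _ h₂, .nil _, .nil _, hseg _ h₄ _ h₃,
      hseg _ h₂ _ h₃, ?_⟩
    rw [hdist, hdist, hdist, abs_of_nonpos (by linarith), abs_of_nonneg (by linarith),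
      abs_of_nonpos (by linarith)]
    nlinarith [dist_nonneg (x := x) (y := y), h₁.1, h₄.2]
  have k3 : ∀ s₁ ∈ Set.Icc (0 : ℝ) 1, ∀ s₂ ∈ Set.Icc (0 : ℝ) 1, ∀ s₃ ∈ Set.Icc (0 : ℝ) 1,
      ∀ s₄ ∈ Set.Icc (0 : ℝ) 1, s₁ ≤ s₂ → s₂ ≤ s₃ → G s₁ s₂ s₃ s₄ := by
    intro s₁ h₁ s₂ h₂ s₃ h₃ s₄ h₄ h12 h23
    rcases le_total s₃ s₄ with h | h
    · exact k4 _ h₁ _ h₂ _ h₃ _ h₄ h12 h23 h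
    rcases le_total s₂ s₄ with h' | h'
    · exact (k4 _ h₁ _ h₂ _ h₄ _ h₃ h12 h' h).swap34
    rcases le_total s₁ s₄ with h'' | h''
    · exact (k4 _ h₁ _ h₄ _ h₂ _ h₃ h'' h' h23).swap23.swap34
    · exact (k4 _ h₄ _ h₁ _ h₂ _ h₃ h'' h12 h23).swap12.swap23.swap34
  have k2 : ∀ s₁ ∈ Set.Icc (0 : ℝ) 1, ∀ s₂ ∈ Set.Icc (0 : ℝ) 1, ∀ s₃ ∈ Set.Icc (0 : ℝ) 1,
      ∀ s₄ ∈ Set.Icc (0 : ℝ) 1, s₁ ≤ s₂ → G s₁ s₂ s₃ s₄ := by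
    intro s₁ h₁ s₂ h₂ s₃ h₃ s₄ h₄ h12
    rcases le_total s₂ s₃ with h | h
    · exact k3 _ h₁ _ h₂ _ h₃ _ h₄ h12 h
    rcases le_total s₁ s₃ with h' | h'
    · exact (k3 _ h₁ _ h₃ _ h₂ _ h₄ h' h).swap23
    · exact (k3 _ h₃ _ h₁ _ h₂ _ h₄ h' h12).swap12.swap23
  intro A hA B hB C hC D hD
  rw [segment_eq_image_lineMap] at hA hB hC hD
  obtain ⟨s₁, h₁, rfl⟩ := hA
  obtain ⟨s₂, h₂, rfl⟩ := hB
  obtain ⟨s₃, h₃, rfl⟩ := hC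
  obtain ⟨s₄, h₄, rfl⟩ := hD
  rcases le_total s₁ s₂ with h | h
  · exact k2 _ h₁ _ h₂ _ h₃ _ h₄ h
  · exact (k2 _ h₂ _ h₁ _ h₃ _ h₄ h).swap12

end FourTrees

/-! ### Connected systems of segments -/

theorem carrier_nil : carrier [] = ∅ := by simp [carrier]

theorem carrier_cons (e : Plane × Plane) (L : SegmentSystem) :
    carrier (e :: L) = segment ℝ e.1 e.2 ∪ carrier L := by
  simp [carrier, Set.iUnion_or, Set.iUnion_union_distrib]

theorem totalLength_cons (e : Plane × Plane) (L : SegmentSystem) :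
    totalLength (e :: L) = dist e.1 e.2 + totalLength L := by
  simp [totalLength]

theorem carrier_append (L M : SegmentSystem) : carrier (L ++ M) = carrier L ∪ carrier M := by
  induction L with
  | nil => simp [carrier_nil]
  | cons e L ih => rw [List.cons_append, carrier_cons, carrier_cons, ih, Set.union_assoc]

theorem carrier_perm {L M : SegmentSystem} (h : L.Perm M) : carrier L = carrier M := by
  simp only [carrier, h.mem_iff]

theorem totalLength_perm {L M : SegmentSystem} (h : L.Perm M) : totalLength L = totalLength M :=
  (h.map _).sum_eq

theorem isCompact_segment (x y : Plane) : IsCompact (segment ℝ x y) := by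
  rw [segment_eq_image_lineMap]
  exact isCompact_Icc.image AffineMap.lineMap_continuous

theorem isCompact_carrier (L : SegmentSystem) : IsCompact (carrier L) := by
  induction L with
  | nil => simp [carrier_nil]
  | cons e L ih => rw [carrier_cons]; exact (isCompact_segment _ _).union ih

theorem exists_segment_inter_of_isPreconnected {L M : SegmentSystem} (hL : (carrier L).Nonempty)
    (hM : (carrier M).Nonempty) (h : IsPreconnected (carrier (L ++ M))) :
    ∃ e ∈ M, (carrier L ∩ segment ℝ e.1 e.2).Nonempty := by
  rw [carrier_append] at h
  obtain ⟨x, -, hxL, hxM⟩ := isPreconnected_closed_iff.1 h _ _ (isCompact_carrier L).isClosed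
    (isCompact_carrier M).isClosed subset_rfl
    (hL.mono fun x hx => ⟨.inl hx, hx⟩) (hM.mono fun x hx => ⟨.inr hx, hx⟩)
  simp only [carrier, Set.mem_iUnion] at hxM
  obtain ⟨e, he, hx⟩ := hxM
  exact ⟨e, he, x, hxL, hx⟩

/-- `L` is the part already assembled and `M` the rest. Connectedness of the whole supplies a
segment of `M` that meets `L`, which is moved over; `n` counts what is left. -/
theorem spansFour_append (n : ℕ) : ∀ L M : SegmentSystem, M.length = n → (carrier L).Nonempty →
    SpansFour (carrier L) (totalLength L) → IsPreconnected (carrier (L ++ M)) →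
    SpansFour (carrier (L ++ M)) (totalLength (L ++ M)) := by
  induction n with
  | zero =>
    intro L M hn hne hL hc
    obtain rfl := List.length_eq_zero_iff.1 hn
    simpa using hL
  | succ n ih =>
    intro L M hn hne hL hc
    have hM : (carrier M).Nonempty := by
      cases M with
      | nil => simp at hn
      | cons e M => exact ⟨e.1, by rw [carrier_cons]; exact .inl (left_mem_segment _ _ _)⟩
    obtain ⟨e, he, x, hxL, hx⟩ := exists_segment_inter_of_isPreconnected hne hM hc
    classical
    have hperm : (L ++ M).Perm ((e :: L) ++ M.erase e) :=
      ((List.perm_cons_erase he).append_left L).trans List.perm_middle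
    rw [carrier_perm hperm, totalLength_perm hperm]
    rw [carrier_perm hperm] at hc
    refine ih _ _ (by rw [List.length_erase_of_mem he, hn]; rfl) ?_ ?_ hc
    · exact hne.mono (by rw [carrier_cons]; exact Set.subset_union_right)
    · rw [carrier_cons, totalLength_cons]
      exact (spansFour_segment _ _).union hL hx hxL

theorem spansFour_of_isConnected {L : SegmentSystem} (h : IsConnected (carrier L)) :
    SpansFour (carrier L) (totalLength L) := by
  cases L with
  | nil => exact absurd h.nonempty (by simp [carrier_nil])
  | cons e L =>
    refine spansFour_append _ [e] L rfl ?_ ?_ h.isPreconnected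
    · exact ⟨e.1, by rw [carrier_cons]; exact .inl (left_mem_segment _ _ _)⟩
    · simpa [carrier, totalLength] using spansFour_segment e.1 e.2

end SteinerFour

namespace SteinerFour

/-! ### Coordinates in the plane -/

/-- The signed area of the parallelogram spanned by `x` and `y`. -/
def cross (x y : Plane) : ℝ := x 0 * y 1 - x 1 * y 0

theorem inner_eq (x y : Plane) : inner ℝ x y = x 0 * y 0 + x 1 * y 1 := by
  simp [PiLp.inner_apply, Fin.sum_univ_two, mul_comm]

theorem norm_sq_eq (x : Plane) : ‖x‖ ^ 2 = x 0 ^ 2 + x 1 ^ 2 := by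
  rw [← real_inner_self_eq_norm_sq, inner_eq]; ring

theorem plane_ext {x y : Plane} (h0 : x 0 = y 0) (h1 : x 1 = y 1) : x = y := by
  ext i; fin_cases i <;> assumption

theorem inner_sq_add_cross_sq (x y : Plane) :
    inner ℝ x y ^ 2 + cross x y ^ 2 = ‖x‖ ^ 2 * ‖y‖ ^ 2 := by
  rw [inner_eq, norm_sq_eq, norm_sq_eq, cross]; ring

/-! ### The angles at a Steiner point -/

theorem hasDerivAt_norm_add_smul {x : Plane} (hx : x ≠ 0) (v : Plane) :
    HasDerivAt (fun t : ℝ => ‖x + t • v‖) (inner ℝ (‖x‖⁻¹ • x) v) 0 := by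
  have h1 : HasDerivAt (fun t : ℝ => x + t • v) v 0 := by
    simpa using ((hasDerivAt_id (0 : ℝ)).smul_const v).const_add x
  have h2 := h1.norm_sq.sqrt (by simpa using hx)
  convert h2 using 1
  · ext t; simp
  · simp [real_inner_smul_left]; field_simp

/-- Away from the vertices the sum of distances is differentiable, and its derivative in each
direction vanishes at the minimum. -/
theorem sum_unit_vectors_eq_zero {A B C S : Plane} (hA : A ≠ S) (hB : B ≠ S) (hC : C ≠ S)
    (h : ∀ X : Plane, dist S A + dist S B + dist S C ≤ dist X A + dist X B + dist X C) :
    ‖A - S‖⁻¹ • (A - S) + ‖B - S‖⁻¹ • (B - S) + ‖C - S‖⁻¹ • (C - S) = 0 := by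
  have key : ∀ v : Plane, inner ℝ
      (‖A - S‖⁻¹ • (A - S) + ‖B - S‖⁻¹ • (B - S) + ‖C - S‖⁻¹ • (C - S)) v = 0 := by
    intro v
    have hd := ((hasDerivAt_norm_add_smul (sub_ne_zero.2 hA) v).add
      (hasDerivAt_norm_add_smul (sub_ne_zero.2 hB) v)).add
      (hasDerivAt_norm_add_smul (sub_ne_zero.2 hC) v)
    rw [inner_add_left, inner_add_left]
    refine IsLocalMin.hasDerivAt_eq_zero (Filter.Eventually.of_forall fun t => ?_) hd
    have := h (S - t • v)
    have e : ∀ D : Plane, dist (S - t • v) D = ‖D - S + t • v‖ := fun D => by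
      rw [dist_comm, dist_eq_norm]; congr 1; abel
    simp only [e] at this
    simpa [dist_eq_norm, norm_sub_rev S] using this
  exact inner_self_eq_zero.1 (key _)

theorem inner_of_sum_eq_zero {u v w : Plane} (hu : ‖u‖ = 1) (hv : ‖v‖ = 1) (hw : ‖w‖ = 1)
    (h : u + v + w = 0) : inner ℝ u v = -(1 / 2 : ℝ) := by
  have h1 : ‖u + v‖ = 1 := by
    rw [eq_neg_of_add_eq_zero_left h, norm_neg, hw]
  have := norm_add_sq_real u v
  rw [h1, hu, hv] at this
  linarith

theorem cross_sq_of_sum_eq_zero {u v w : Plane} (hu : ‖u‖ = 1) (hv : ‖v‖ = 1) (hw : ‖w‖ = 1)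
    (h : u + v + w = 0) : cross u v ^ 2 = 3 / 4 := by
  have := inner_sq_add_cross_sq u v
  rw [inner_of_sum_eq_zero hu hv hw h, hu, hv] at this
  linarith

/-- The rotation by a right angle. -/
noncomputable def quarterTurn (u : Plane) : Plane := !₂[-u 1, u 0]

theorem eq_combination {u : Plane} (hu : ‖u‖ = 1) (v : Plane) :
    v = inner ℝ u v • u + cross u v • quarterTurn u := by
  have h := norm_sq_eq u
  rw [hu] at h
  apply plane_ext
  · simp [inner_eq, cross, quarterTurn]; linear_combination (v 0) * h
  · simp [inner_eq, cross, quarterTurn]; linear_combination (v 1) * h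

theorem signedArea_combination {u : Plane} (hu : ‖u‖ = 1) (S : Plane) (x₁ y₁ x₂ y₂ x₃ y₃ : ℝ) :
    signedArea (S + (x₁ • u + y₁ • quarterTurn u)) (S + (x₂ • u + y₂ • quarterTurn u))
        (S + (x₃ • u + y₃ • quarterTurn u))
      = (x₂ - x₁) * (y₃ - y₁) - (y₂ - y₁) * (x₃ - x₁) := by
  have h := norm_sq_eq u
  rw [hu] at h
  simp [signedArea, quarterTurn]
  linear_combination (-((x₂ - x₁) * (y₃ - y₁) - (y₂ - y₁) * (x₃ - x₁))) * h

/-- The shape of a full Steiner tree: at both Steiner points the edges have the directions of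
the unit vectors `u`, `v`, `w` with sum zero, up to sign; the lengths of the edges are
`a`, `b`, `c`, `d` and `l`. -/
structure IsSteinerFrame (P₁ P₂ P₃ P₄ S₁ S₂ u v w : Plane) (a b c d l : ℝ) : Prop where
  norm_u : ‖u‖ = 1
  norm_v : ‖v‖ = 1
  norm_w : ‖w‖ = 1
  sum_eq : u + v + w = 0
  cross_eq : cross u v = √3 / 2
  a_pos : 0 < a
  b_pos : 0 < b
  c_pos : 0 < c
  d_pos : 0 < d
  l_pos : 0 < l
  P₁_eq : P₁ = S₁ + a • v
  P₂_eq : P₂ = S₁ + b • w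
  S₂_eq : S₂ = S₁ + l • u
  P₃_eq : P₃ = S₂ - c • v
  P₄_eq : P₄ = S₂ - d • w

theorem norm_normalize {x : Plane} (hx : x ≠ 0) : ‖‖x‖⁻¹ • x‖ = 1 := by
  rw [norm_smul, norm_inv, norm_norm, inv_mul_cancel₀ (norm_ne_zero_iff.2 hx)]

/-- The 120° condition fixes the directions at each Steiner point up to reflection in the line S₁S₂.
Convexity excludes the choices in which the tree is not a counterclockwise zigzag. -/
theorem exists_isSteinerFrame {P₁ P₂ P₃ P₄ S₁ S₂ : Plane}
    (hP : IsConvexQuadrilateral P₁ P₂ P₃ P₄) (hT : IsFullSteinerTree P₁ P₂ P₃ P₄ S₁ S₂) :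
    ∃ (u v w : Plane) (a b c d l : ℝ), IsSteinerFrame P₁ P₂ P₃ P₄ S₁ S₂ u v w a b c d l := by
  have hn := hT.vertices_distinct
  simp only [List.nodup_cons, List.mem_cons, List.not_mem_nil, or_false, not_or] at hn
  obtain ⟨⟨-, -, -, h11, -⟩, ⟨-, -, h21, -⟩, ⟨-, -, h32⟩, ⟨-, h42⟩, h12, -⟩ := hn
  have d1 : P₁ - S₁ ≠ 0 := sub_ne_zero.2 h11
  have d2 : P₂ - S₁ ≠ 0 := sub_ne_zero.2 h21
  have d3 : P₃ - S₂ ≠ 0 := sub_ne_zero.2 h32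
  have d4 : P₄ - S₂ ≠ 0 := sub_ne_zero.2 h42
  have d5 : S₂ - S₁ ≠ 0 := sub_ne_zero.2 (Ne.symm h12)
  have hl := sum_unit_vectors_eq_zero h11 h21 (Ne.symm h12) hT.steiner_point_left.minimizes
  have hr := sum_unit_vectors_eq_zero h32 h42 h12 hT.steiner_point_right.minimizes
  have scale : ∀ {x : Plane}, x ≠ 0 → ‖x‖ • (‖x‖⁻¹ • x) = x := fun {x} hx => by
    rw [smul_smul, mul_inv_cancel₀ (norm_ne_zero_iff.2 hx), one_smul]
  have e1 := scale d1
  have e2 := scale d2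
  have e3 := scale d3
  have e4 := scale d4
  have e5 := scale d5
  have n1 := norm_normalize d1
  have n2 := norm_normalize d2
  have n3 := norm_normalize d3
  have n4 := norm_normalize d4
  have n5 := norm_normalize d5
  rw [show S₁ - S₂ = -(S₂ - S₁) by abel, norm_neg, smul_neg] at hr
  have p1 := norm_pos_iff.2 d1
  have p2 := norm_pos_iff.2 d2
  have p3 := norm_pos_iff.2 d3
  have p4 := norm_pos_iff.2 d4
  have p5 := norm_pos_iff.2 d5
  generalize ‖P₁ - S₁‖⁻¹ • (P₁ - S₁) = v at *
  generalize ‖P₂ - S₁‖⁻¹ • (P₂ - S₁) = w at *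
  generalize ‖P₃ - S₂‖⁻¹ • (P₃ - S₂) = v' at *
  generalize ‖P₄ - S₂‖⁻¹ • (P₄ - S₂) = w' at *
  generalize ‖S₂ - S₁‖⁻¹ • (S₂ - S₁) = u at *
  generalize ‖P₁ - S₁‖ = a at *
  generalize ‖P₂ - S₁‖ = b at *
  generalize ‖P₃ - S₂‖ = c at *
  generalize ‖P₄ - S₂‖ = d at *
  generalize ‖S₂ - S₁‖ = l at *
  have s1 : u + v + w = 0 := by rw [← hl]; abel
  have s2 : u + -v' + -w' = 0 := by rw [← neg_eq_zero, ← hr]; abel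
  have hv := eq_combination n5 v
  have hv' := eq_combination n5 (-v')
  rw [inner_of_sum_eq_zero n5 n1 n2 s1] at hv
  rw [inner_of_sum_eq_zero n5 (by rwa [norm_neg]) (by rwa [norm_neg]) s2] at hv'
  have c1 := cross_sq_of_sum_eq_zero n5 n1 n2 s1
  have c2 := cross_sq_of_sum_eq_zero n5 (by rwa [norm_neg]) (by rwa [norm_neg]) s2
  -- k and m are the coordinates of v and -v' orthogonal to u; both are ±√3/2, and only their signs
  -- are open.
  obtain ⟨k, hk⟩ : ∃ k, k = cross u v := ⟨_, rfl⟩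
  obtain ⟨m, hm⟩ : ∃ m, m = cross u (-v') := ⟨_, rfl⟩
  rw [← hk] at hv c1
  rw [← hm] at hv' c2
  have q1 : P₁ = S₁ + ((-(a / 2)) • u + (a * k) • quarterTurn u) := by
    rw [← sub_eq_iff_eq_add', ← e1, hv]; module
  have q2 : P₂ = S₁ + ((-(b / 2)) • u + (-(b * k)) • quarterTurn u) := by
    rw [← sub_eq_iff_eq_add', ← e2, show w = -u - v by rw [← sub_eq_zero, ← s1]; abel, hv]; module
  have q0 : S₂ = S₁ + l • u := by rw [← sub_eq_iff_eq_add', ← e5]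
  have q3 : P₃ = S₁ + ((l + c / 2) • u + (-(c * m)) • quarterTurn u) := by
    have : P₃ = S₂ + c • v' := by rw [← sub_eq_iff_eq_add', ← e3]
    rw [this, q0, show v' = - -v' by simp, hv']; module
  have q4 : P₄ = S₁ + ((l + d / 2) • u + (d * m) • quarterTurn u) := by
    have : P₄ = S₂ + d • w' := by rw [← sub_eq_iff_eq_add', ← e4]
    rw [this, q0, show w' = u + -v' by rw [← sub_eq_zero, ← neg_eq_zero, ← s2]; abel, hv']; module
  have t2 := hP.turn₂
  have t3 := hP.turn₃
  rw [q1, q2, q3, signedArea_combination n5] at t2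
  rw [q2, q3, q4, signedArea_combination n5] at t3
  rcases sq_eq_sq_iff_eq_or_eq_neg.1 (c2.trans c1.symm) with h | h
  · rw [h] at t2 hv'
    have kpos : 0 < k := by
      have f : 0 < a * b + b * c + (a + b) * l := by positivity
      exact (mul_pos_iff_of_pos_right f).1 (t2.trans_eq (by ring))
    have kval : k = √3 / 2 := by
      have : (√3) ^ 2 = 3 := Real.sq_sqrt (by norm_num)
      have h0 : 0 ≤ √3 := Real.sqrt_nonneg 3
      nlinarith
    have hvv : v = -v' := hv.trans hv'.symm
    have hww : w = -w' := by
      have : u + v + w = u + -v' + -w' := s1.trans s2.symm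
      rwa [hvv, add_right_inj] at this
    refine ⟨u, v, w, a, b, c, d, l, n5, n1, n2, s1, hk ▸ kval, p1, p2, p3, p4, p5, ?_, ?_, q0,
      ?_, ?_⟩
    · rw [e1]; abel
    · rw [e2]; abel
    · rw [hvv, smul_neg, e3]; abel
    · rw [hww, smul_neg, e4]; abel
  -- For m = -k the turns at P₂ and P₃ would have opposite signs.
  · exfalso
    rw [h] at t2 t3
    have g2 : 0 < k * (a * c + a * b + l * (a + b)) := t2.trans_eq (by ring)
    have g3 : 0 < -k * (l * (d + c) + d * (b + c)) := t3.trans_eq (by ring)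
    have f2 : 0 < a * c + a * b + l * (a + b) := by positivity
    have f3 : 0 < l * (d + c) + d * (b + c) := by positivity
    linarith [(mul_pos_iff_of_pos_right f2).1 g2, (mul_pos_iff_of_pos_right f3).1 g3]

end SteinerFour

namespace SteinerFour

/-! ### Metric properties of the tree -/

namespace IsSteinerFrame

variable {P₁ P₂ P₃ P₄ S₁ S₂ u v w : Plane} {a b c d l : ℝ}

/-- Exchanging the two ends of the tree transfers every statement about S₁ to S₂. -/
theorem symm (F : IsSteinerFrame P₁ P₂ P₃ P₄ S₁ S₂ u v w a b c d l) :
    IsSteinerFrame P₃ P₄ P₁ P₂ S₂ S₁ (-u) (-v) (-w) c d a b l where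
  norm_u := by rw [norm_neg, F.norm_u]
  norm_v := by rw [norm_neg, F.norm_v]
  norm_w := by rw [norm_neg, F.norm_w]
  sum_eq := by rw [← neg_eq_zero, ← F.sum_eq]; abel
  cross_eq := by rw [← F.cross_eq]; simp [cross]
  a_pos := F.c_pos
  b_pos := F.d_pos
  c_pos := F.a_pos
  d_pos := F.b_pos
  l_pos := F.l_pos
  P₁_eq := by rw [F.P₃_eq]; module
  P₂_eq := by rw [F.P₄_eq]; module
  S₂_eq := by rw [F.S₂_eq]; module
  P₃_eq := by rw [F.P₁_eq]; module
  P₄_eq := by rw [F.P₂_eq]; module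

theorem w_eq (F : IsSteinerFrame P₁ P₂ P₃ P₄ S₁ S₂ u v w a b c d l) : w = -u - v := by
  rw [← sub_eq_zero, ← F.sum_eq]; abel

theorem u_eq (F : IsSteinerFrame P₁ P₂ P₃ P₄ S₁ S₂ u v w a b c d l) : u = -v - w := by
  rw [← sub_eq_zero, ← F.sum_eq]; abel

theorem inner_u_v (F : IsSteinerFrame P₁ P₂ P₃ P₄ S₁ S₂ u v w a b c d l) :
    inner ℝ u v = -(1 / 2 : ℝ) :=
  inner_of_sum_eq_zero F.norm_u F.norm_v F.norm_w F.sum_eq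

theorem inner_v_w (F : IsSteinerFrame P₁ P₂ P₃ P₄ S₁ S₂ u v w a b c d l) :
    inner ℝ v w = -(1 / 2 : ℝ) :=
  inner_of_sum_eq_zero F.norm_v F.norm_w F.norm_u (by rw [← F.sum_eq]; abel)

theorem inner_u_w (F : IsSteinerFrame P₁ P₂ P₃ P₄ S₁ S₂ u v w a b c d l) :
    inner ℝ u w = -(1 / 2 : ℝ) :=
  inner_of_sum_eq_zero F.norm_u F.norm_w F.norm_v (by rw [← F.sum_eq]; abel)

theorem cross_v_w (F : IsSteinerFrame P₁ P₂ P₃ P₄ S₁ S₂ u v w a b c d l) :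
    cross v w = √3 / 2 := by
  rw [← F.cross_eq, F.w_eq]; simp [cross]; ring

theorem eq_zero_of_combination (F : IsSteinerFrame P₁ P₂ P₃ P₄ S₁ S₂ u v w a b c d l) {x y : ℝ}
    (h : x • v + y • w = 0) : x = 0 ∧ y = 0 := by
  have hc : cross v w ≠ 0 := by rw [F.cross_v_w]; positivity
  have h0 := congrArg (fun z : Plane => z 0) h
  have h1 := congrArg (fun z : Plane => z 1) h
  simp at h0 h1
  constructor
  · refine (mul_eq_zero.1 (?_ : x * cross v w = 0)).resolve_right hc
    rw [cross]; linear_combination w 1 * h0 - w 0 * h1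
  · refine (mul_eq_zero.1 (?_ : y * cross v w = 0)).resolve_right hc
    rw [cross]; linear_combination v 0 * h1 - v 1 * h0

theorem dist_P₁ (F : IsSteinerFrame P₁ P₂ P₃ P₄ S₁ S₂ u v w a b c d l) : dist P₁ S₁ = a := by
  rw [F.P₁_eq, dist_eq_norm, add_sub_cancel_left, norm_smul, F.norm_v, mul_one,
    Real.norm_of_nonneg F.a_pos.le]

theorem dist_P₂ (F : IsSteinerFrame P₁ P₂ P₃ P₄ S₁ S₂ u v w a b c d l) : dist P₂ S₁ = b := by
  rw [F.P₂_eq, dist_eq_norm, add_sub_cancel_left, norm_smul, F.norm_w, mul_one,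
    Real.norm_of_nonneg F.b_pos.le]

theorem dist_S (F : IsSteinerFrame P₁ P₂ P₃ P₄ S₁ S₂ u v w a b c d l) : dist S₁ S₂ = l := by
  rw [F.S₂_eq, dist_comm, dist_eq_norm, add_sub_cancel_left, norm_smul, F.norm_u, mul_one,
    Real.norm_of_nonneg F.l_pos.le]

theorem totalLength_eq (F : IsSteinerFrame P₁ P₂ P₃ P₄ S₁ S₂ u v w a b c d l) :
    totalLength (treeEdges P₁ P₂ P₃ P₄ S₁ S₂) = a + b + c + d + l := by
  simp only [totalLength, treeEdges, List.map_cons, List.map_nil, List.sum_cons, List.sum_nil,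
    F.dist_P₁, F.dist_P₂, F.dist_S, F.symm.dist_P₁, F.symm.dist_P₂]
  ring

theorem diagonal₁ (F : IsSteinerFrame P₁ P₂ P₃ P₄ S₁ S₂ u v w a b c d l) :
    P₃ - P₁ = l • u - (a + c) • v := by
  rw [F.P₃_eq, F.P₁_eq, F.S₂_eq]; module

theorem diagonal₂ (F : IsSteinerFrame P₁ P₂ P₃ P₄ S₁ S₂ u v w a b c d l) :
    P₄ - P₂ = l • u - (b + d) • w := by
  rw [F.P₄_eq, F.P₂_eq, F.S₂_eq]; module

theorem inner_diagonals (F : IsSteinerFrame P₁ P₂ P₃ P₄ S₁ S₂ u v w a b c d l) :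
    inner ℝ (P₃ - P₁) (P₄ - P₂)
      = l ^ 2 + l * (a + b + c + d) / 2 - (a + c) * (b + d) / 2 := by
  rw [F.diagonal₁, F.diagonal₂]
  simp only [inner_sub_left, inner_sub_right, real_inner_smul_left, real_inner_smul_right,
    real_inner_self_eq_norm_sq, norm_smul, F.norm_u, F.inner_u_w, real_inner_comm u v, F.inner_u_v,
    F.inner_v_w, mul_one, Real.norm_eq_abs, sq_abs]
  ring

theorem cross_diagonals (F : IsSteinerFrame P₁ P₂ P₃ P₄ S₁ S₂ u v w a b c d l) :
    cross (P₃ - P₁) (P₄ - P₂) = √3 / 2 * (l * (a + b + c + d) + (a + c) * (b + d)) := by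
  rw [F.diagonal₁, F.diagonal₂, ← F.cross_eq, F.w_eq]
  simp [cross]
  ring

theorem norm_sq_diagonal₁ (F : IsSteinerFrame P₁ P₂ P₃ P₄ S₁ S₂ u v w a b c d l) :
    ‖P₃ - P₁‖ ^ 2 = l ^ 2 + (a + c) ^ 2 + l * (a + c) := by
  rw [F.diagonal₁, norm_sub_sq_real, norm_smul, norm_smul, F.norm_u, F.norm_v,
    real_inner_smul_left, real_inner_smul_right, F.inner_u_v, mul_one, mul_one, Real.norm_eq_abs,
    Real.norm_eq_abs, sq_abs, sq_abs]
  ring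

theorem norm_sq_diagonal₂ (F : IsSteinerFrame P₁ P₂ P₃ P₄ S₁ S₂ u v w a b c d l) :
    ‖P₄ - P₂‖ ^ 2 = l ^ 2 + (b + d) ^ 2 + l * (b + d) := by
  rw [F.diagonal₂, norm_sub_sq_real, norm_smul, norm_smul, F.norm_u, F.norm_w,
    real_inner_smul_left, real_inner_smul_right, F.inner_u_w, mul_one, mul_one, Real.norm_eq_abs,
    Real.norm_eq_abs, sq_abs, sq_abs]
  ring

theorem cross_diagonals_pos (F : IsSteinerFrame P₁ P₂ P₃ P₄ S₁ S₂ u v w a b c d l) :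
    0 < cross (P₃ - P₁) (P₄ - P₂) := by
  have := F.a_pos; have := F.b_pos; have := F.c_pos; have := F.d_pos; have := F.l_pos
  rw [F.cross_diagonals]; positivity

/-- The only negative term of the inner product, a multiple of (a + c)(b + d), cancels. For
diagonals at angle θ the inequality says cos(θ - π/6) > 0. -/
theorem inner_add_cross_pos (F : IsSteinerFrame P₁ P₂ P₃ P₄ S₁ S₂ u v w a b c d l) :
    0 < √3 * inner ℝ (P₃ - P₁) (P₄ - P₂) + cross (P₃ - P₁) (P₄ - P₂) := by
  have := F.a_pos; have := F.b_pos; have := F.c_pos; have := F.d_pos; have := F.l_pos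
  have h : 0 < √3 * (l ^ 2 + l * (a + b + c + d)) := by positivity
  rw [F.inner_diagonals, F.cross_diagonals]
  exact h.trans_eq (by ring)

/-- The length is expressed through the diagonals alone, so two trees can be compared without
relating their edges. -/
theorem length_sq (F : IsSteinerFrame P₁ P₂ P₃ P₄ S₁ S₂ u v w a b c d l) :
    (a + b + c + d + l) ^ 2 = ‖P₃ - P₁‖ ^ 2 + ‖P₄ - P₂‖ ^ 2 - inner ℝ (P₃ - P₁) (P₄ - P₂)
      + √3 * cross (P₃ - P₁) (P₄ - P₂) := by
  have h3 : √3 ^ 2 = 3 := Real.sq_sqrt (by norm_num)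
  rw [F.norm_sq_diagonal₁, F.norm_sq_diagonal₂, F.inner_diagonals, F.cross_diagonals]
  linear_combination (-(l * (a + b + c + d) + (a + c) * (b + d)) / 2) * h3

theorem angle_diagonals_lt (F : IsSteinerFrame P₁ P₂ P₃ P₄ S₁ S₂ u v w a b c d l) :
    InnerProductGeometry.angle (P₃ - P₁) (P₄ - P₂) < 2 * Real.pi / 3 := by
  have h1 := F.inner_add_cross_pos
  have h2 := F.cross_diagonals_pos
  have h3 := inner_sq_add_cross_sq (P₃ - P₁) (P₄ - P₂)
  have h4 : √3 ^ 2 = 3 := Real.sq_sqrt (by norm_num)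
  have h5 : 0 < √3 := by positivity
  rw [← mul_pow] at h3
  set x : ℝ := inner ℝ (P₃ - P₁) (P₄ - P₂)
  set y := cross (P₃ - P₁) (P₄ - P₂)
  set N := ‖P₃ - P₁‖ * ‖P₄ - P₂‖
  have hN : 0 ≤ N := by positivity
  have hNpos : 0 < N := by
    rcases hN.eq_or_lt with h | h
    · rw [← h] at h3; nlinarith [sq_nonneg x, pow_pos h2 2]
    · exact h
  have hx : -(1 / 2) * N < x := by
    -- Otherwise 3x² < y², hence N² = x² + y² > 4x² ≥ N².
    by_contra! hx
    have h6 : (√3 * -x) ^ 2 < y ^ 2 := by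
      apply pow_lt_pow_left₀ _ _ two_ne_zero
      · linarith
      · exact mul_nonneg h5.le (by linarith)
    have h7 : (1 / 2 * N) ^ 2 ≤ (-x) ^ 2 := pow_le_pow_left₀ (by linarith) (by linarith) 2
    nlinarith
  have hcos : Real.cos (2 * Real.pi / 3) = -(1 / 2) := by
    rw [show 2 * Real.pi / 3 = Real.pi - Real.pi / 3 by ring, Real.cos_pi_sub,
      Real.cos_pi_div_three]
  by_contra! hge
  have := Real.cos_le_cos_of_nonneg_of_le_pi (by positivity)
    (InnerProductGeometry.angle_le_pi (P₃ - P₁) (P₄ - P₂)) hge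
  rw [hcos, InnerProductGeometry.cos_angle, div_le_iff₀ hNpos] at this
  linarith

/-- S and T are arbitrary: each enters with coefficient ±(u + v + w) = 0. By Cauchy-Schwarz every
summand is at most an edge length of the competing tree. -/
theorem length_eq_inner (F : IsSteinerFrame P₁ P₂ P₃ P₄ S₁ S₂ u v w a b c d l) (S T : Plane) :
    a + b + c + d + l = inner ℝ (P₁ - S) v + inner ℝ (P₂ - S) w + inner ℝ (P₃ - T) (-v)
      + inner ℝ (P₄ - T) (-w) + inner ℝ (T - S) u := by
  have e : inner ℝ (P₁ - S) v + inner ℝ (P₂ - S) w + inner ℝ (P₃ - T) (-v)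
      + inner ℝ (P₄ - T) (-w) + inner ℝ (T - S) u
      = inner ℝ (P₁ - P₃) v + inner ℝ (P₂ - P₄) w := by
    rw [F.u_eq]
    simp only [inner_sub_left, inner_sub_right, inner_neg_right]
    ring
  rw [e, ← neg_sub, ← neg_sub P₄, F.diagonal₁, F.diagonal₂]
  simp only [inner_neg_left, inner_sub_left, real_inner_smul_left, F.inner_u_v, F.inner_u_w,
    real_inner_self_eq_norm_sq, F.norm_v, F.norm_w]
  ring

theorem inner_le_dist {e x y : Plane} (he : ‖e‖ = 1) : inner ℝ (x - y) e ≤ dist x y := by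
  simpa [he, dist_eq_norm] using real_inner_le_norm (x - y) e

theorem sub_eq_dist_smul {e x y : Plane} (he : ‖e‖ = 1) (h : dist x y ≤ inner ℝ (x - y) e) :
    x - y = dist x y • e := by
  have := inner_eq_norm_mul_iff_real (x := x - y) (y := e)
  rw [he, mul_one, one_smul, ← dist_eq_norm] at this
  exact this.1 (le_antisymm (inner_le_dist he) h)

theorem length_le (F : IsSteinerFrame P₁ P₂ P₃ P₄ S₁ S₂ u v w a b c d l) (S T : Plane) :
    a + b + c + d + l ≤ dist P₁ S + dist P₂ S + dist P₃ T + dist P₄ T + dist S T := by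
  rw [F.length_eq_inner S T, dist_comm S T]
  have h1 := inner_le_dist (x := P₁) (y := S) F.norm_v
  have h2 := inner_le_dist (x := P₂) (y := S) F.norm_w
  have h3 := inner_le_dist (x := P₃) (y := T) F.symm.norm_v
  have h4 := inner_le_dist (x := P₄) (y := T) F.symm.norm_w
  have h5 := inner_le_dist (x := T) (y := S) F.norm_u
  linarith

/-- Every Cauchy-Schwarz inequality is an equality, so S lies on the lines through P₁ and P₂ with
the independent directions v and w; these meet only in S₁. The other end follows by symmetry. -/
theorem eq_of_length_eq (F : IsSteinerFrame P₁ P₂ P₃ P₄ S₁ S₂ u v w a b c d l) {S T : Plane}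
    (h : dist P₁ S + dist P₂ S + dist P₃ T + dist P₄ T + dist S T ≤ a + b + c + d + l) :
    S = S₁ ∧ T = S₂ := by
  rw [F.length_eq_inner S T, dist_comm S T] at h
  have h1 := inner_le_dist (x := P₁) (y := S) F.norm_v
  have h2 := inner_le_dist (x := P₂) (y := S) F.norm_w
  have h3 := inner_le_dist (x := P₃) (y := T) F.symm.norm_v
  have h4 := inner_le_dist (x := P₄) (y := T) F.symm.norm_w
  have h5 := inner_le_dist (x := T) (y := S) F.norm_u
  have g1 := sub_eq_dist_smul (x := P₁) (y := S) F.norm_v (by linarith)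
  have g2 := sub_eq_dist_smul (x := P₂) (y := S) F.norm_w (by linarith)
  have g3 := sub_eq_dist_smul (x := P₃) (y := T) F.symm.norm_v (by linarith)
  have g4 := sub_eq_dist_smul (x := P₄) (y := T) F.symm.norm_w (by linarith)
  have key : ∀ {P₁ P₂ P₃ P₄ S₁ S₂ u v w : Plane} {a b c d l : ℝ} {S : Plane},
      IsSteinerFrame P₁ P₂ P₃ P₄ S₁ S₂ u v w a b c d l →
      P₁ - S = dist P₁ S • v → P₂ - S = dist P₂ S • w → S = S₁ := by
    intro P₁ P₂ P₃ P₄ S₁ S₂ u v w a b c d l S F g1 g2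
    have e : (dist P₁ S - a) • v + (b - dist P₂ S) • w = 0 := by
      rw [sub_smul, sub_smul, ← g1, ← g2, F.P₁_eq, F.P₂_eq]; module
    rw [sub_eq_zero.1 (F.eq_zero_of_combination e).1] at g1
    rw [F.P₁_eq, add_sub_right_comm, add_eq_right, sub_eq_zero] at g1
    exact g1.symm
  exact ⟨key F g1 g2, key F.symm g3 g4⟩

theorem length_lt_diagonals (F : IsSteinerFrame P₁ P₂ P₃ P₄ S₁ S₂ u v w a b c d l) :
    a + b + c + d + l < dist P₁ P₃ + dist P₂ P₄ := by
  have h1 := F.inner_add_cross_pos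
  have h3 := inner_sq_add_cross_sq (P₃ - P₁) (P₄ - P₂)
  have h4 : √3 ^ 2 = 3 := Real.sq_sqrt (by norm_num)
  rw [dist_comm P₁, dist_comm P₂, dist_eq_norm, dist_eq_norm]
  apply lt_of_pow_lt_pow_left₀ 2 (by positivity)
  rw [F.length_sq]
  set x : ℝ := inner ℝ (P₃ - P₁) (P₄ - P₂)
  set y := cross (P₃ - P₁) (P₄ - P₂)
  have h5 : -x + √3 * y < 2 * (‖P₃ - P₁‖ * ‖P₄ - P₂‖) := by
    apply lt_of_pow_lt_pow_left₀ 2 (by positivity)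
    -- The square of √3x + y, positive by `inner_add_cross_pos`, is exactly the gap in
    -- Cauchy-Schwarz and makes the bound strict.
    have : (-x + √3 * y) ^ 2 + (√3 * x + y) ^ 2 = 4 * (x ^ 2 + y ^ 2) := by
      linear_combination (x ^ 2 + y ^ 2) * h4
    rw [h3] at this
    nlinarith [pow_pos h1 2]
  linarith

end IsSteinerFrame

end SteinerFour

namespace SteinerFour

/-! ### The angles formed by the diagonals -/

/-- Zero vectors need no exception: their angle is π/2 by convention. -/
theorem angle_lt_pi_div_two_iff (x y : Plane) :
    InnerProductGeometry.angle x y < Real.pi / 2 ↔ 0 < inner ℝ x y := by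
  rw [InnerProductGeometry.angle, Real.arccos_lt_pi_div_two]
  refine ⟨fun h => ?_, fun h => ?_⟩
  · by_contra! hn
    exact absurd h (not_lt.2 (div_nonpos_of_nonpos_of_nonneg hn (by positivity)))
  · exact div_pos h (h.trans_le (real_inner_le_norm x y))

/-- The diagonals of `P₁P₂P₃P₄` have the directions `p` and `q` and cross at `X`. -/
structure IsDiagonalPoint (P₁ P₂ P₃ P₄ X p q : Plane) (s s' t t' : ℝ) : Prop where
  s_pos : 0 < s
  s'_pos : 0 < s'
  t_pos : 0 < t
  t'_pos : 0 < t'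
  cross_pos : 0 < cross p q
  P₁_eq : P₁ = X - s • p
  P₂_eq : P₂ = X - t • q
  P₃_eq : P₃ = X + s' • p
  P₄_eq : P₄ = X + t' • q

namespace IsDiagonalPoint

variable {P₁ P₂ P₃ P₄ X p q : Plane} {s s' t t' : ℝ}

theorem rotate (h : IsDiagonalPoint P₁ P₂ P₃ P₄ X p q s s' t t') :
    IsDiagonalPoint P₄ P₁ P₂ P₃ X (-q) p t' t s s' where
  s_pos := h.t'_pos
  s'_pos := h.t_pos
  t_pos := h.s_pos
  t'_pos := h.s'_pos
  cross_pos := h.cross_pos.trans_eq (by simp [cross]; ring)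
  P₁_eq := by rw [h.P₄_eq]; module
  P₂_eq := h.P₁_eq
  P₃_eq := by rw [h.P₂_eq]; module
  P₄_eq := h.P₃_eq

/-- Relative to X, the coordinate along p is negative in the first angle and positive in the second.
-/
theorem notMem_angleInterior (h : IsDiagonalPoint P₁ P₂ P₃ P₄ X p q s s' t t') {Y : Plane}
    (hY : Y ∈ angleInterior P₁ X P₂) : Y ∉ angleInterior P₂ X P₃ := by
  rintro ⟨x', y', hx', hy', h2⟩
  obtain ⟨x, y, hx, hy, h1⟩ := hY
  have h3 : (x * s + y' * s') • p = (x' * t - y * t) • q := by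
    rw [h1, h.P₁_eq, h.P₂_eq, h.P₃_eq, ← sub_eq_zero] at h2
    rw [← sub_eq_zero, ← neg_eq_zero, ← h2]
    module
  have h4 : (x * s + y' * s') * cross p q = 0 := by
    have h0 := congrArg (fun z : Plane => z 0) h3
    have h1 := congrArg (fun z : Plane => z 1) h3
    simp at h0 h1
    rw [cross]; linear_combination q 1 * h0 - q 0 * h1
  have := h.s_pos
  have := h.s'_pos
  have := h.cross_pos
  have : 0 < (x * s + y' * s') * cross p q := by positivity
  linarith

theorem angle_lt_iff (h : IsDiagonalPoint P₁ P₂ P₃ P₄ X p q s s' t t') :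
    ∠ P₁ X P₂ < Real.pi / 2 ↔ 0 < inner ℝ p q := by
  have e : inner ℝ (P₁ -ᵥ X) (P₂ -ᵥ X) = s * t * inner ℝ p q := by
    rw [show P₁ -ᵥ X = -(s • p) by rw [h.P₁_eq, vsub_eq_sub]; abel,
      show P₂ -ᵥ X = -(t • q) by rw [h.P₂_eq, vsub_eq_sub]; abel,
      inner_neg_neg, real_inner_smul_left, real_inner_smul_right]
    ring
  rw [EuclideanGeometry.angle, angle_lt_pi_div_two_iff, e,
    mul_pos_iff_of_pos_left (mul_pos h.s_pos h.t_pos)]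

end IsDiagonalPoint

namespace IsSteinerFrame

variable {P₁ P₂ P₃ P₄ S₁ S₂ u v w X : Plane} {a b c d l : ℝ}

theorem exists_diagonalPoint (F : IsSteinerFrame P₁ P₂ P₃ P₄ S₁ S₂ u v w a b c d l) :
    ∃ X, X ∈ segment ℝ P₁ P₃ ∩ segment ℝ P₂ P₄ := by
  have := F.a_pos; have := F.b_pos; have := F.c_pos; have := F.d_pos; have := F.l_pos
  have hΔ : 0 < (a + c) * (b + d) + l * (a + b + c + d) := by positivity
  -- The parameter solves the linear system for the crossing point in the basis v, w; the
  -- denominator is the cross product of the diagonals up to the factor √3/2.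
  refine ⟨P₁ + ((a * (b + d + l) + b * l) / ((a + c) * (b + d) + l * (a + b + c + d))) • (P₃ - P₁),
    ?_, ?_⟩
  · rw [segment_eq_image']
    exact ⟨_, ⟨by positivity, (div_le_one hΔ).2 (by nlinarith)⟩, rfl⟩
  · rw [segment_eq_image']
    refine ⟨(b * (a + c + l) + a * l) / ((a + c) * (b + d) + l * (a + b + c + d)),
      ⟨by positivity, (div_le_one hΔ).2 (by nlinarith)⟩, ?_⟩
    beta_reduce
    rw [F.diagonal₁, F.diagonal₂, F.P₁_eq, F.P₂_eq, F.u_eq]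
    match_scalars <;> field_simp <;> ring

theorem diagonal_parameters (F : IsSteinerFrame P₁ P₂ P₃ P₄ S₁ S₂ u v w a b c d l)
    (hX : X ∈ segment ℝ P₁ P₃ ∩ segment ℝ P₂ P₄) :
    ∃ s t : ℝ, s * ((a + c) * (b + d) + l * (a + b + c + d)) = a * (b + d + l) + b * l ∧
      t * ((a + c) * (b + d) + l * (a + b + c + d)) = b * (a + c + l) + a * l ∧
      X = P₁ + s • (P₃ - P₁) ∧ X = P₂ + t • (P₄ - P₂) := by
  obtain ⟨h1, h2⟩ := hX
  rw [segment_eq_image'] at h1 h2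
  obtain ⟨s, -, h1⟩ := h1
  obtain ⟨t, -, h2⟩ := h2
  beta_reduce at h1 h2
  have h3 : (a - s * (a + c + l) + t * l) • v + (t * (b + d + l) - b - s * l) • w = 0 := by
    rw [← sub_eq_zero.2 (h1.trans h2.symm), F.diagonal₁, F.diagonal₂, F.P₁_eq, F.P₂_eq, F.u_eq]
    module
  obtain ⟨g1, g2⟩ := F.eq_zero_of_combination h3
  refine ⟨s, t, ?_, ?_, h1.symm, h2.symm⟩
  · linear_combination -(b + d + l) * g1 + l * g2
  · linear_combination -l * g1 + (a + c + l) * g2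

theorem isDiagonalPoint (F : IsSteinerFrame P₁ P₂ P₃ P₄ S₁ S₂ u v w a b c d l)
    (hX : X ∈ segment ℝ P₁ P₃ ∩ segment ℝ P₂ P₄) :
    ∃ s s' t t' : ℝ, IsDiagonalPoint P₁ P₂ P₃ P₄ X (P₃ - P₁) (P₄ - P₂) s s' t t' := by
  have := F.a_pos; have := F.b_pos; have := F.c_pos; have := F.d_pos; have := F.l_pos
  have hΔ : 0 < (a + c) * (b + d) + l * (a + b + c + d) := by positivity
  obtain ⟨s, t, hs, ht, h1, h2⟩ := F.diagonal_parameters hX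
  refine ⟨s, 1 - s, t, 1 - t, ?_, ?_, ?_, ?_, F.cross_diagonals_pos, ?_, ?_, ?_, ?_⟩
  · exact (mul_pos_iff_of_pos_right hΔ).1 (by rw [hs]; positivity)
  · exact (mul_pos_iff_of_pos_right hΔ).1 (by rw [sub_mul, hs]; ring_nf; positivity)
  · exact (mul_pos_iff_of_pos_right hΔ).1 (by rw [ht]; positivity)
  · exact (mul_pos_iff_of_pos_right hΔ).1 (by rw [sub_mul, ht]; ring_nf; positivity)
  · rw [h1]; module
  · rw [h2]; module
  · rw [h1]; module
  · rw [h2]; module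

theorem mem_angleInterior (F : IsSteinerFrame P₁ P₂ P₃ P₄ S₁ S₂ u v w a b c d l)
    (hX : X ∈ segment ℝ P₁ P₃ ∩ segment ℝ P₂ P₄) : S₁ ∈ angleInterior P₁ X P₂ := by
  have := F.a_pos; have := F.b_pos; have := F.c_pos; have := F.d_pos; have := F.l_pos
  set Δ := (a + c) * (b + d) + l * (a + b + c + d) with hΔd
  have hΔ : 0 < Δ := by positivity
  obtain ⟨s, t, hs, ht, h1, h2⟩ := F.diagonal_parameters hX
  rw [← hΔd] at hs ht
  have s0 : 0 < s := (mul_pos_iff_of_pos_right hΔ).1 (by rw [hs]; positivity)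
  have t0 : 0 < t := (mul_pos_iff_of_pos_right hΔ).1 (by rw [ht]; positivity)
  -- In the basis of the diagonals S₁ - X has coordinates -bl/Δ and -al/Δ, while P₁ - X and P₂ - X
  -- are -s and -t times the diagonals.
  refine ⟨b * l / (s * Δ), a * l / (t * Δ), by positivity, by positivity, ?_⟩
  have e1 : P₁ - X = -(s • (P₃ - P₁)) := by rw [h1]; module
  have e2 : P₂ - X = -(t • (P₄ - P₂)) := by rw [h2]; module
  have hsd : s = (a * (b + d + l) + b * l) / Δ := by rw [eq_div_iff hΔ.ne', hs]
  rw [e1, e2, smul_neg, smul_neg, smul_smul, smul_smul,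
    show b * l / (s * Δ) * s = b * l / Δ by field_simp,
    show a * l / (t * Δ) * t = a * l / Δ by field_simp, h1, F.diagonal₁, F.diagonal₂, F.P₁_eq,
    F.u_eq, hsd]
  match_scalars <;> field_simp <;> rw [hΔd] <;> ring

theorem mem_vertical_angles (F : IsSteinerFrame P₁ P₂ P₃ P₄ S₁ S₂ u v w a b c d l)
    (hX : X ∈ segment ℝ P₁ P₃ ∩ segment ℝ P₂ P₄) :
    S₁ ∈ angleInterior P₁ X P₂ ∧ S₂ ∈ angleInterior P₃ X P₄ :=
  ⟨F.mem_angleInterior hX, F.symm.mem_angleInterior (by rwa [segment_symm ℝ P₃, segment_symm ℝ P₄])⟩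

theorem lieInAcuteVerticalAngles_iff (F : IsSteinerFrame P₁ P₂ P₃ P₄ S₁ S₂ u v w a b c d l) :
    LieInAcuteVerticalAngles P₁ P₂ P₃ P₄ S₁ S₂ ↔ 0 < inner ℝ (P₃ - P₁) (P₄ - P₂) := by
  constructor
  · rintro ⟨X, hX, h⟩
    obtain ⟨s, s', t, t', H⟩ := F.isDiagonalPoint hX
    obtain ⟨m1, m2⟩ := F.mem_vertical_angles hX
    rcases h with ⟨h, -⟩ | ⟨-, ⟨h, -⟩ | ⟨h, -⟩⟩
    · exact H.angle_lt_iff.1 h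
    · exact absurd h (H.notMem_angleInterior m1)
    · exact absurd m1 (H.rotate.notMem_angleInterior h)
  · intro h
    obtain ⟨X, hX⟩ := F.exists_diagonalPoint
    obtain ⟨s, s', t, t', H⟩ := F.isDiagonalPoint hX
    exact ⟨X, hX, .inl ⟨H.angle_lt_iff.2 h, .inl (F.mem_vertical_angles hX)⟩⟩

end IsSteinerFrame

theorem lieInVerticalAngles_swap {U V U' V' X Y Z : Plane} :
    LieInVerticalAngles U V U' V' X Y Z ↔ LieInVerticalAngles U' V' U V X Y Z :=
  or_comm

/-- The acute vertical angles do not depend on the vertex at which the numbering starts. -/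
theorem IsSteinerFrame.lieInAcuteVerticalAngles_rotate {P₁ P₂ P₃ P₄ S₁ S₂ u v w : Plane}
    {a b c d l : ℝ} (F : IsSteinerFrame P₁ P₂ P₃ P₄ S₁ S₂ u v w a b c d l) (Y Z : Plane) :
    LieInAcuteVerticalAngles P₁ P₂ P₃ P₄ Y Z ↔ LieInAcuteVerticalAngles P₄ P₁ P₂ P₃ Y Z := by
  have hangle : ∀ X ∈ segment ℝ P₁ P₃ ∩ segment ℝ P₂ P₄,
      (∠ P₄ X P₁ < Real.pi / 2 ↔ ∠ P₂ X P₃ < Real.pi / 2) := by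
    intro X hX
    obtain ⟨s, s', t, t', H⟩ := F.isDiagonalPoint hX
    rw [H.rotate.angle_lt_iff, H.rotate.rotate.rotate.angle_lt_iff]
    simp only [inner_neg_left, inner_neg_right, neg_neg, real_inner_comm]
  have hinter : segment ℝ P₄ P₂ ∩ segment ℝ P₁ P₃ = segment ℝ P₁ P₃ ∩ segment ℝ P₂ P₄ := by
    rw [segment_symm ℝ P₄, Set.inter_comm]
  unfold LieInAcuteVerticalAngles
  rw [hinter]
  refine exists_congr fun X => and_congr_right fun hX => ?_
  rw [hangle X hX, lieInVerticalAngles_swap (U := P₂), or_comm]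

end SteinerFour

namespace SteinerFour

open MeasureTheory

/-! ### Total length and the one-dimensional Hausdorff measure -/

theorem totalLength_nonneg (L : SegmentSystem) : 0 ≤ totalLength L :=
  List.sum_nonneg fun x hx => by
    obtain ⟨e, -, rfl⟩ := List.mem_map.1 hx
    exact dist_nonneg

theorem hausdorffMeasure_carrier_le (L : SegmentSystem) :
    μH[1] (carrier L) ≤ ENNReal.ofReal (totalLength L) := by
  induction L with
  | nil => simp [carrier_nil]
  | cons e L ih =>
    rw [carrier_cons, totalLength_cons, ENNReal.ofReal_add dist_nonneg (totalLength_nonneg L),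
      ← edist_dist, ← hausdorffMeasure_segment]
    exact (measure_union_le _ _).trans (by gcongr)

theorem hausdorffMeasure_carrier_eq {L : SegmentSystem}
    (h : L.Pairwise fun e f =>
      segment ℝ e.1 e.2 ∩ segment ℝ f.1 f.2 ⊆ {e.1, e.2} ∩ {f.1, f.2}) :
    μH[1] (carrier L) = ENNReal.ofReal (totalLength L) := by
  induction L with
  | nil => simp [carrier_nil, totalLength]
  | cons e L ih =>
    obtain ⟨he, hL⟩ := List.pairwise_cons.1 h
    have : NullSingletonClass (μH[1] : Measure Plane) :=
      Measure.nullSingletonClass_hausdorff Plane one_pos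
    have hnull : AEDisjoint μH[1] (segment ℝ e.1 e.2) (carrier L) := by
      refine measure_mono_null (t := {e.1, e.2}) ?_ (Set.Finite.measure_zero (Set.toFinite _) _)
      rintro x ⟨hx, hxL⟩
      simp only [carrier, Set.mem_iUnion] at hxL
      obtain ⟨f, hf, hxf⟩ := hxL
      exact (he f hf ⟨hx, hxf⟩).1
    rw [carrier_cons, totalLength_cons, ENNReal.ofReal_add dist_nonneg (totalLength_nonneg L),
      ← edist_dist, ← hausdorffMeasure_segment, ← ih hL]
    exact measure_union₀ (isCompact_carrier L).measurableSet.nullMeasurableSet hnull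

/-- By connectedness the distance from x takes every value in [0, r) on K; being 1-Lipschitz, it
does not increase the measure. -/
theorem ofReal_le_hausdorffMeasure_inter_ball {K : Set Plane} (hK : IsPreconnected K)
    {x y : Plane} {r : ℝ} (hx : x ∈ K) (hy : y ∈ K) (hr : r ≤ dist y x) :
    ENNReal.ofReal r ≤ μH[1] (K ∩ Metric.ball x r) := by
  have hsub : Set.Ico 0 r ⊆ (fun z => dist z x) '' (K ∩ Metric.ball x r) := by
    intro t ht
    have := hK.intermediate_value hx hy (f := fun z => dist z x) (by fun_prop)
    obtain ⟨z, hz, rfl⟩ := this ⟨by simpa using ht.1, ht.2.le.trans hr⟩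
    exact ⟨z, ⟨hz, ht.2⟩, rfl⟩
  calc ENNReal.ofReal r = μH[1] (Set.Ico (0 : ℝ) r) := by
        rw [hausdorffMeasure_real, Real.volume_Ico, sub_zero]
    _ ≤ μH[1] ((fun z => dist z x) '' (K ∩ Metric.ball x r)) := measure_mono hsub
    _ ≤ μH[1] (K ∩ Metric.ball x r) := by
        simpa using (LipschitzWith.dist_left x).hausdorffMeasure_image_le zero_le_one
          (K ∩ Metric.ball x r)

/-- A connected system of segments that contains the union of a system without overlaps and is
not longer has the same union. -/
theorem carrier_eq_of_subset {L L' : SegmentSystem} (hL : (carrier L).Nonempty)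
    (h : L.Pairwise fun e f =>
      segment ℝ e.1 e.2 ∩ segment ℝ f.1 f.2 ⊆ {e.1, e.2} ∩ {f.1, f.2})
    (hL' : IsPreconnected (carrier L')) (hsub : carrier L ⊆ carrier L')
    (hlen : totalLength L' ≤ totalLength L) : carrier L' = carrier L := by
  refine Set.Subset.antisymm (fun x hx => ?_) hsub
  by_contra hxL
  -- An extra point has a ball free of the smaller union, in which the larger one has measure at
  -- least r. As the smaller system has no overlaps, its measure is its length, so the larger would
  -- be longer by r.
  obtain ⟨r, hr, hball⟩ := Metric.isOpen_iff.1 (isCompact_carrier L).isClosed.isOpen_compl x hxL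
  obtain ⟨y, hy⟩ := hL
  have hyr : r ≤ dist y x := by
    by_contra! hlt
    exact hball hlt hy
  have h1 := ofReal_le_hausdorffMeasure_inter_ball hL' hx (hsub hy) hyr
  have hdisj : Disjoint (carrier L) (carrier L' ∩ Metric.ball x r) :=
    Set.disjoint_left.2 fun z hz hz' => hball hz'.2 hz
  have h2 : μH[1] (carrier L) + μH[1] (carrier L' ∩ Metric.ball x r) ≤ μH[1] (carrier L') := by
    rw [← measure_union' hdisj (isCompact_carrier L).measurableSet]
    exact measure_mono (Set.union_subset hsub Set.inter_subset_left)
  rw [hausdorffMeasure_carrier_eq h] at h2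
  have h3 := (add_le_add_right h1 _).trans (h2.trans (hausdorffMeasure_carrier_le L'))
  rw [← ENNReal.ofReal_add (totalLength_nonneg L) hr.le,
    ENNReal.ofReal_le_ofReal_iff (totalLength_nonneg L')] at h3
  linarith

/-! ### Minimality -/

theorem carrier_treeEdges (A B C D S T : Plane) :
    carrier (treeEdges A B C D S T) = segment ℝ A S ∪ (segment ℝ B S ∪ (segment ℝ S T ∪
      (segment ℝ C T ∪ segment ℝ D T))) := by
  simp only [treeEdges, carrier_cons, carrier_nil, Set.union_empty]

theorem interconnects_treeEdges (A B C D S T : Plane) :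
    Interconnects (treeEdges A B C D S T) {A, B, C, D} := by
  have hs : ∀ x y : Plane, IsConnected (segment ℝ x y) := fun x y =>
    (convex_segment x y).isConnected ⟨x, left_mem_segment _ _ _⟩
  refine ⟨?_, ?_⟩
  · rw [carrier_treeEdges]
    have hl : ∀ x y : Plane, x ∈ segment ℝ x y := fun x y => left_mem_segment _ _ _
    have hr : ∀ x y : Plane, y ∈ segment ℝ x y := fun x y => right_mem_segment _ _ _
    refine (hs A S).union ⟨S, hr _ _, .inl (hr _ _)⟩ ?_
    refine (hs B S).union ⟨S, hr _ _, .inl (hl _ _)⟩ ?_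
    refine (hs S T).union ⟨T, hr _ _, .inl (hr _ _)⟩ ?_
    exact (hs C T).union ⟨T, hr _ _, hr _ _⟩ (hs D T)
  · rw [carrier_treeEdges]
    rintro x (rfl | rfl | rfl | rfl)
    · exact .inl (left_mem_segment _ _ _)
    · exact .inr (.inl (left_mem_segment _ _ _))
    · exact .inr (.inr (.inr (.inl (left_mem_segment _ _ _))))
    · exact .inr (.inr (.inr (.inr (left_mem_segment _ _ _))))

theorem HasFourTree.exists_dist_le {K : Set Plane} {A B C D : Plane} {ℓ : ℝ}
    (h : HasFourTree K A B C D ℓ) :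
    ∃ S T, dist A S + dist B S + dist C T + dist D T + dist S T ≤ ℓ := by
  obtain ⟨S, T, a, b, c, d, e, ha, hb, hc, hd, he, hl⟩ := h
  exact ⟨S, T, by linarith [ha.dist_le, hb.dist_le, hc.dist_le, hd.dist_le, he.dist_le]⟩

theorem HasFourTree.dist_add_dist_le {K : Set Plane} {A B C D : Plane} {ℓ : ℝ}
    (h : HasFourTree K A B C D ℓ) : dist A B + dist C D ≤ ℓ := by
  obtain ⟨S, T, h⟩ := h.exists_dist_le
  linarith [dist_triangle_right A B S, dist_triangle_right C D T, dist_nonneg (x := S) (y := T)]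

theorem Interconnects.hasSomeFourTree {L : SegmentSystem} {A B C D : Plane}
    (h : Interconnects L {A, B, C, D}) : HasSomeFourTree (carrier L) A B C D (totalLength L) :=
  spansFour_of_isConnected h.1 A (h.2 (by simp)) B (h.2 (by simp)) C (h.2 (by simp)) D
    (h.2 (by simp))

namespace IsSteinerFrame

variable {P₁ P₂ P₃ P₄ S₁ S₂ u v w S₁' S₂' u' v' w' : Plane} {a b c d l a' b' c' d' l' : ℝ}

theorem length_le_of_hasFourTree (F : IsSteinerFrame P₁ P₂ P₃ P₄ S₁ S₂ u v w a b c d l)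
    {K : Set Plane} {ℓ : ℝ} (h : HasFourTree K P₁ P₂ P₃ P₄ ℓ) : a + b + c + d + l ≤ ℓ := by
  obtain ⟨S, T, h⟩ := h.exists_dist_le
  exact (F.length_le S T).trans h

/-- Equality of lengths identifies the inner vertices with S₁ and S₂, and then forces each of the
five paths to be straight. -/
theorem carrier_subset_of_hasFourTree (F : IsSteinerFrame P₁ P₂ P₃ P₄ S₁ S₂ u v w a b c d l)
    {K : Set Plane} {ℓ : ℝ} (h : HasFourTree K P₁ P₂ P₃ P₄ ℓ) (hℓ : ℓ ≤ a + b + c + d + l) :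
    carrier (treeEdges P₁ P₂ P₃ P₄ S₁ S₂) ⊆ K := by
  obtain ⟨S, T, x₁, x₂, x₃, x₄, x₅, h1, h2, h3, h4, h5, hl⟩ := h
  have g1 := h1.dist_le
  have g2 := h2.dist_le
  have g3 := h3.dist_le
  have g4 := h4.dist_le
  have g5 := h5.dist_le
  obtain ⟨rfl, rfl⟩ := F.eq_of_length_eq (S := S) (T := T) (by linarith)
  have e1 := F.dist_P₁
  have e2 := F.dist_P₂
  have e3 := F.symm.dist_P₁
  have e4 := F.symm.dist_P₂
  have e5 := F.dist_S
  rw [carrier_treeEdges]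
  refine Set.union_subset (h1.segment_subset (dist_pos.1 (e1 ▸ F.a_pos)) (by linarith)) <|
    Set.union_subset (h2.segment_subset (dist_pos.1 (e2 ▸ F.b_pos)) (by linarith)) <|
    Set.union_subset (h5.segment_subset (dist_pos.1 (e5 ▸ F.l_pos)) (by linarith)) <|
    Set.union_subset (h3.segment_subset (dist_pos.1 (e3 ▸ F.c_pos)) (by linarith))
      (h4.segment_subset (dist_pos.1 (e4 ▸ F.d_pos)) (by linarith))

theorem length_sq_sub_length_sq (F : IsSteinerFrame P₁ P₂ P₃ P₄ S₁ S₂ u v w a b c d l)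
    (F' : IsSteinerFrame P₄ P₁ P₂ P₃ S₁' S₂' u' v' w' a' b' c' d' l') :
    (a + b + c + d + l) ^ 2 - (a' + b' + c' + d' + l') ^ 2
      = -2 * inner ℝ (P₃ - P₁) (P₄ - P₂) := by
  rw [F.length_sq, F'.length_sq, norm_sub_rev P₂ P₄, ← neg_sub P₄ P₂, inner_neg_left,
    real_inner_comm]
  simp only [cross, PiLp.neg_apply]
  ring

theorem length_pos (F : IsSteinerFrame P₁ P₂ P₃ P₄ S₁ S₂ u v w a b c d l) :
    0 < a + b + c + d + l := by
  linarith [F.a_pos, F.b_pos, F.c_pos, F.d_pos, F.l_pos]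

theorem length_le_length (F : IsSteinerFrame P₁ P₂ P₃ P₄ S₁ S₂ u v w a b c d l)
    (F' : IsSteinerFrame P₄ P₁ P₂ P₃ S₁' S₂' u' v' w' a' b' c' d' l')
    (h : 0 ≤ inner ℝ (P₃ - P₁) (P₄ - P₂)) :
    a + b + c + d + l ≤ a' + b' + c' + d' + l' :=
  le_of_sq_le_sq (by linarith [F.length_sq_sub_length_sq F']) F'.length_pos.le

theorem length_lt_length (F : IsSteinerFrame P₁ P₂ P₃ P₄ S₁ S₂ u v w a b c d l)
    (F' : IsSteinerFrame P₄ P₁ P₂ P₃ S₁' S₂' u' v' w' a' b' c' d' l')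
    (h : 0 < inner ℝ (P₃ - P₁) (P₄ - P₂)) :
    a + b + c + d + l < a' + b' + c' + d' + l' :=
  lt_of_pow_lt_pow_left₀ 2 F'.length_pos.le (by linarith [F.length_sq_sub_length_sq F'])

theorem isSteinerMinimal (F : IsSteinerFrame P₁ P₂ P₃ P₄ S₁ S₂ u v w a b c d l)
    (F' : IsSteinerFrame P₄ P₁ P₂ P₃ S₁' S₂' u' v' w' a' b' c' d' l')
    (h : 0 ≤ inner ℝ (P₃ - P₁) (P₄ - P₂)) :
    IsSteinerMinimal {P₁, P₂, P₃, P₄} (treeEdges P₁ P₂ P₃ P₄ S₁ S₂) := by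
  refine ⟨interconnects_treeEdges _ _ _ _ _ _, fun L hL => ?_⟩
  rw [F.totalLength_eq]
  rcases hL.hasSomeFourTree with g | g | g
  · exact F.length_le_of_hasFourTree g
  · exact F.length_lt_diagonals.le.trans g.dist_add_dist_le
  · exact (F.length_le_length F' h).trans (F'.length_le_of_hasFourTree g.swap_left)

theorem isUniqueSteinerMinimal (F : IsSteinerFrame P₁ P₂ P₃ P₄ S₁ S₂ u v w a b c d l)
    (F' : IsSteinerFrame P₄ P₁ P₂ P₃ S₁' S₂' u' v' w' a' b' c' d' l')
    (hT : IsFullSteinerTree P₁ P₂ P₃ P₄ S₁ S₂) (h : 0 < inner ℝ (P₃ - P₁) (P₄ - P₂)) :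
    IsUniqueSteinerMinimal {P₁, P₂, P₃, P₄} (treeEdges P₁ P₂ P₃ P₄ S₁ S₂) := by
  have hmin := F.isSteinerMinimal F' h.le
  refine ⟨hmin, fun L hL => ?_⟩
  have hlen := hL.2 _ hmin.1
  refine carrier_eq_of_subset hmin.1.1.nonempty hT.not_self_intersecting hL.1.1.isPreconnected
    ?_ hlen
  rw [F.totalLength_eq] at hlen
  rcases hL.1.hasSomeFourTree with g | g | g
  · exact F.carrier_subset_of_hasFourTree g hlen
  · exact absurd (F.length_lt_diagonals.trans_le g.dist_add_dist_le) (not_lt.2 hlen)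
  · exact absurd ((F.length_lt_length F' h).trans_le (F'.length_le_of_hasFourTree g.swap_left))
      (not_lt.2 hlen)

end IsSteinerFrame

theorem IsConvexQuadrilateral.rotate {P₁ P₂ P₃ P₄ : Plane}
    (h : IsConvexQuadrilateral P₁ P₂ P₃ P₄) : IsConvexQuadrilateral P₄ P₁ P₂ P₃ :=
  ⟨h.turn₁, h.turn₂, h.turn₃, h.turn₄⟩

end SteinerFour

/-! ### The main theorem. -/

theorem corollary4p2 (P₁ P₂ P₃ P₄ : Plane) (hP : IsConvexQuadrilateral P₁ P₂ P₃ P₄)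
    (S₁ S₂ S₁' S₂' : Plane)
    (hT : IsFullSteinerTree P₁ P₂ P₃ P₄ S₁ S₂)
    (hT' : IsFullSteinerTree P₄ P₁ P₂ P₃ S₁' S₂') :
    -- the angles between the diagonals
    (InnerProductGeometry.angle (P₃ - P₁) (P₄ - P₂) < 2 * Real.pi / 3 ∧
      InnerProductGeometry.angle (P₃ - P₁) (P₂ - P₄) < 2 * Real.pi / 3) ∧
    -- the lengths of the two trees
    totalLength (treeEdges P₁ P₂ P₃ P₄ S₁ S₂) ^ 2
        - totalLength (treeEdges P₄ P₁ P₂ P₃ S₁' S₂') ^ 2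
      = -2 * inner ℝ (P₃ - P₁) (P₄ - P₂) ∧
    -- perpendicular diagonals
    (inner ℝ (P₃ - P₁) (P₄ - P₂) = 0 →
      IsSteinerMinimal {P₁, P₂, P₃, P₄} (treeEdges P₁ P₂ P₃ P₄ S₁ S₂) ∧
      IsSteinerMinimal {P₁, P₂, P₃, P₄} (treeEdges P₄ P₁ P₂ P₃ S₁' S₂')) ∧
    -- diagonals that are not perpendicular
    (inner ℝ (P₃ - P₁) (P₄ - P₂) ≠ 0 →
      Xor (LieInAcuteVerticalAngles P₁ P₂ P₃ P₄ S₁ S₂)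
        (LieInAcuteVerticalAngles P₁ P₂ P₃ P₄ S₁' S₂') ∧
      (LieInAcuteVerticalAngles P₁ P₂ P₃ P₄ S₁ S₂ →
        IsUniqueSteinerMinimal {P₁, P₂, P₃, P₄} (treeEdges P₁ P₂ P₃ P₄ S₁ S₂)) ∧
      (LieInAcuteVerticalAngles P₁ P₂ P₃ P₄ S₁' S₂' →
        IsUniqueSteinerMinimal {P₁, P₂, P₃, P₄} (treeEdges P₄ P₁ P₂ P₃ S₁' S₂'))) := by
  obtain ⟨u, v, w, a, b, c, d, l, F⟩ := exists_isSteinerFrame hP hT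
  obtain ⟨u', v', w', a', b', c', d', l', F'⟩ := exists_isSteinerFrame hP.rotate hT'
  have hinner : inner ℝ (P₂ - P₄) (P₃ - P₁) = -inner ℝ (P₃ - P₁) (P₄ - P₂) := by
    rw [← neg_sub P₄ P₂, inner_neg_left, real_inner_comm]
  have hset : ({P₄, P₁, P₂, P₃} : Set Plane) = {P₁, P₂, P₃, P₄} := by
    ext x
    simp only [Set.mem_insert_iff, Set.mem_singleton_iff]
    tauto
  have hacute := F.lieInAcuteVerticalAngles_iff
  have hacute' := (F.lieInAcuteVerticalAngles_rotate S₁' S₂').trans F'.lieInAcuteVerticalAngles_iff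
  rw [hinner, neg_pos] at hacute'
  refine ⟨⟨F.angle_diagonals_lt, ?_⟩, ?_, fun h => ⟨F.isSteinerMinimal F' h.ge, ?_⟩,
    fun h => ⟨?_, fun hS => F.isUniqueSteinerMinimal F' hT (hacute.1 hS), fun hS => ?_⟩⟩
  · rw [InnerProductGeometry.angle_comm]
    exact F'.angle_diagonals_lt
  · rw [F.totalLength_eq, F'.totalLength_eq, F.length_sq_sub_length_sq F']
  · rw [← hset]
    -- The roles of the trees are exchanged: rotating the numbering of the second tree once more
    -- gives P₃, P₄, P₁, P₂, for which the first tree has the frame `F.symm`.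
    exact F'.isSteinerMinimal F.symm (by rw [hinner, h, neg_zero])
  · rw [hacute, hacute']
    rcases lt_or_gt_of_ne h with h | h
    · exact .inr ⟨h, h.not_gt⟩
    · exact .inl ⟨h, h.not_gt⟩
  · rw [← hset]
    exact F'.isUniqueSteinerMinimal F.symm hT' (by rw [hinner]; linarith [hacute'.1 hS])
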